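/- Let $k$ be a field and let $A$ be a finite-dimensional Hopf algebra over $k$ with coproduct $\Delta(a)=a_{(1)}\otimes a_{(2)}$, counit $\epsilon$ and antipode $s$. The dual $A^*$ is an algebra under $(pq)(a)=p(a_{(1)})q(a_{(2)})$. For $a,b\in A$ and $p\in A^*$ write $(p{\leftharpoonup}a)(b)=p(ab)$, $a{\leftharpoonup}p=p(a_{(1)})a_{(2)}$, $\ell(a)(b)=ab$ and $r(p)(a)=a{\leftharpoonup}p$. Let $\int_r$ be the set of right integrals for $A$, that is, of all $\Lambda\in A$ with $\Lambda a=\epsilon(a)\Lambda$ for all $a\in A$, and let $\int^r$ be the set of right integrals for $A^*$, that is, of all $\lambda\in A^*$ with $\lambda p=p(1)\lambda$ for all $p\in A^*$. An endomorphism $\mathcal P$ of the vector space $A$ is called an integral and cointegral for $A$ if $\mathcal P(a_{(1)})\otimes a_{(2)}=\mathcal P(a)\otimes 1$ and $\mathcal P(a)b=\epsilon(b)\mathcal P(a)$ for all $a,b\in A$. Let $\mathcal E:\operatorname{End}(A)\to\operatorname{End}(A)$ be the linear map determined by $$p(\mathcal E(f)(a))=\operatorname{tr}(\ell(a)\circ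 f\circ r(p))\qquad\text{for all } p\in A^*,\ f\in\operatorname{End}(A),\ a\in A.$$ Then the antipode $s$ is bijective, and $\mathcal P=\mathcal E(s^{-2})$ is an integral and cointegral for $A$ with $\mathcal P\neq 0$ and $\operatorname{tr}\mathcal P\neq 0$. Moreover there exist $\lambda\in\int^r$ and $\Lambda\in\int_r$ with $\lambda(\Lambda)=1$ such that the map $f:A\to A^*$, $f(a)=\lambda{\leftharpoonup}s(a)$, is a linear isomorphism satisfying $$f(ab)=f(b){\leftharpoonup}s(a)\quad\text{and}\quad f(a{\leftharpoonup}p)=f(a)p\qquad\text{for all } a,b\in A,\ p\in A^*.$$ -/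

import Mathlib

open scoped TensorProduct

namespace HopfTrace

section Coalgebra

variable {k A : Type*} [Field k] [AddCommGroup A] [Module k A] [Coalgebra k A]

/-- The product of the dual algebra `A*`: `(p q)(a) = p(a₍₁₎) q(a₍₂₎)`. -/
noncomputable def dualMul (p q : Module.Dual k A) : Module.Dual k A :=
  (WithConv.toConv p * WithConv.toConv q).ofConv

theorem dualMul_apply (p q : Module.Dual k A) (a : A) :
    dualMul p q a = LinearMap.mul' k k (TensorProduct.map p q (Coalgebra.comul a)) := rfl

/-- The endomorphism `r(p)` of `A`, that is `r(p)(a) = a ↼ p = p(a₍₁₎) a₍₂₎`. -/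
noncomputable def rightAct (p : Module.Dual k A) : Module.End k A :=
  (TensorProduct.lid k A).toLinearMap ∘ₗ LinearMap.rTensor A p ∘ₗ Coalgebra.comul

end Coalgebra

section Hopf

variable {k A : Type*} [Field k] [Ring A] [HopfAlgebra k A]

/-- The functional `p ↼ a`, that is `(p ↼ a)(b) = p(a b)`. -/
noncomputable def dualRightAct (p : Module.Dual k A) (a : A) : Module.Dual k A :=
  p ∘ₗ LinearMap.mulLeft k a

/-- Right integrals for `A`: elements `Λ` with `Λ a = ε(a) Λ` for all `a ∈ A`. -/
def IsRightIntegral (k : Type*) {A : Type*} [Field k] [Ring A] [HopfAlgebra k A] (Λ : A) : Prop :=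
  ∀ a : A, Λ * a = (Coalgebra.counit a : k) • Λ

/-- Right integrals for `A*`: functionals `lam` with `lam p = p(1) lam` for all `p ∈ A*`. -/
def IsDualRightIntegral (lam : Module.Dual k A) : Prop :=
  ∀ p : Module.Dual k A, dualMul lam p = p 1 • lam

/-- `P` is an integral and cointegral for `A`:
`P(a₍₁₎) ⊗ a₍₂₎ = P(a) ⊗ 1` and `P(a) b = ε(b) P(a)` for all `a, b ∈ A`. -/
def IsIntegralCointegral (P : Module.End k A) : Prop :=
  (∀ a : A, LinearMap.rTensor A P (Coalgebra.comul a) = P a ⊗ₜ[k] (1 : A)) ∧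
    ∀ a b : A, P a * b = (Coalgebra.counit b : k) • P a

/-- The bilinear form `(a, p) ↦ tr(ℓ(a) ∘ f ∘ r(p))`, as a linear map `A → A**`. -/
noncomputable def traceForm (f : Module.End k A) :
    A →ₗ[k] Module.Dual k (Module.Dual k A) :=
  LinearMap.mk₂ k
    (fun a p => LinearMap.trace k A (LinearMap.mulLeft k a ∘ₗ f ∘ₗ rightAct p))
    (fun a b p => by
      have h : LinearMap.mulLeft k (a + b) = LinearMap.mulLeft k a + LinearMap.mulLeft k b := by
        ext x; simp [add_mul]
      rw [h, LinearMap.add_comp, map_add])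
    (fun c a p => by
      have h : LinearMap.mulLeft k (c • a) = c • LinearMap.mulLeft k a := by
        ext x; simp
      rw [h, LinearMap.smul_comp, map_smul])
    (fun a p q => by
      simp only [rightAct, LinearMap.rTensor_add, LinearMap.add_comp, LinearMap.comp_add,
        map_add])
    (fun c a p => by
      simp only [rightAct, LinearMap.rTensor_smul, LinearMap.smul_comp, LinearMap.comp_smul,
        map_smul])

theorem traceForm_apply (f : Module.End k A) (a : A) (p : Module.Dual k A) :
    traceForm f a p = LinearMap.trace k A (LinearMap.mulLeft k a ∘ₗ f ∘ₗ rightAct p) := rfl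

variable [Module.Finite k A]

/-- The endomorphism `𝓔` of `End(A)` with `p(𝓔(f)(a)) = tr(ℓ(a) ∘ f ∘ r(p))` for all `p, a`,
where an element of `A** = A` is determined by its values on `A*`. -/
noncomputable def calE : Module.End k A →ₗ[k] Module.End k A where
  toFun f := (Module.evalEquiv k A).symm.toLinearMap ∘ₗ traceForm f
  map_add' f g := by
    ext a
    simp only [LinearMap.comp_apply, LinearMap.add_apply, ← map_add]
    congr 1
    ext p
    simp only [traceForm_apply, LinearMap.add_apply, LinearMap.add_comp, LinearMap.comp_add, map_add]
  map_smul' c f := by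
    ext a
    simp only [LinearMap.comp_apply, LinearMap.smul_apply, RingHom.id_apply, ← map_smul]
    congr 1
    ext p
    simp only [traceForm_apply, LinearMap.smul_apply, LinearMap.smul_comp, LinearMap.comp_smul,
      map_smul]

/-- The defining property of `𝓔`. -/
theorem apply_calE (f : Module.End k A) (p : Module.Dual k A) (a : A) :
    p (calE f a) = LinearMap.trace k A (LinearMap.mulLeft k a ∘ₗ f ∘ₗ rightAct p) := by
  exact Module.apply_evalEquiv_symm_apply k A p (traceForm f a)

end Hopf

end HopfTrace

/-! Everything comes from traces. For `p` in the dual, b ↦ tr(`leftAct p` ∘ ℓ(b) ∘ s²) is an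
invariant functional (`traceIntegral_rightAct`). Not all of these vanish: s(x₍₂₎)s²(x₍₁₎) = ε(x)1
writes the rank-one map ε ⊗ 1, of trace 1, as a sum of operators whose traces are values of such
functionals (`exists_traceIntegral_ne_zero`).

A nonzero invariant functional pairs nondegenerately with s(A)
(`eq_zero_of_forall_apply_mul_antipode`). Hence s is injective, so bijective by finite dimension.
Composing with s gives a nondegenerate right integral λ for A*, and the preimage of ε under a ↦
λ↼s(a) gives Λ with λ(Λ) = 1.

Finally 𝓔(s⁻²) takes values in the right integrals, which are the multiples of Λ, and preserves λ.
So 𝓔(s⁻²)(a) = λ(a)Λ, with trace λ(Λ) = 1. -/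

open Coalgebra HopfAlgebra WithConv Bialgebra

namespace HopfTrace

/-! ### Contractions and the two commuting actions of the dual. -/

section CoalgebraActions

variable {k A : Type*} [Field k] [AddCommGroup A] [Module k A]

/-- The contraction `u ⊗ v ↦ p(u) v`. -/
noncomputable def contractFst (p : Module.Dual k A) : A ⊗[k] A →ₗ[k] A :=
  (TensorProduct.lid k A).toLinearMap ∘ₗ LinearMap.rTensor A p

/-- The contraction `u ⊗ v ↦ p(v) u`. -/
noncomputable def contractSnd (p : Module.Dual k A) : A ⊗[k] A →ₗ[k] A :=
  (TensorProduct.rid k A).toLinearMap ∘ₗ LinearMap.lTensor A p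

@[simp] theorem contractFst_tmul (p : Module.Dual k A) (u v : A) :
    contractFst p (u ⊗ₜ v) = p u • v := by simp [contractFst]

@[simp] theorem contractSnd_tmul (p : Module.Dual k A) (u v : A) :
    contractSnd p (u ⊗ₜ v) = p v • u := by simp [contractSnd]

theorem apply_contractSnd (p q : Module.Dual k A) (t : A ⊗[k] A) :
    q (contractSnd p t) = p (contractFst q t) := by
  induction t with
  | zero => simp
  | tmul u v => simp [mul_comm]
  | add u v hu hv => simp [hu, hv]

variable [Coalgebra k A]

theorem rightAct_eq (p : Module.Dual k A) (a : A) : rightAct p a = contractFst p (comul a) := rfl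

/-- The endomorphism `a ↦ a₍₁₎ p(a₍₂₎)` of `A`. -/
noncomputable def leftAct (p : Module.Dual k A) : Module.End k A := contractSnd p ∘ₗ comul

theorem leftAct_eq (p : Module.Dual k A) (a : A) : leftAct p a = contractSnd p (comul a) := rfl

theorem rightAct_repr (p : Module.Dual k A) {a : A} {ι : Type*} (R : Coalgebra.Repr k a ι) :
    rightAct p a = ∑ i ∈ R.index, p (R.left i) • R.right i := by
  simp [rightAct_eq, ← R.eq]

theorem leftAct_repr (p : Module.Dual k A) {a : A} {ι : Type*} (R : Coalgebra.Repr k a ι) :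
    leftAct p a = ∑ i ∈ R.index, p (R.right i) • R.left i := by
  simp [leftAct_eq, ← R.eq]

theorem dualMul_eq (p q : Module.Dual k A) (a : A) : dualMul p q a = q (rightAct p a) := by
  rw [dualMul_apply, rightAct_repr p (ℛ k a), ← (ℛ k a).eq]
  simp

theorem apply_leftAct (p q : Module.Dual k A) (a : A) : q (leftAct p a) = p (rightAct q a) :=
  apply_contractSnd p q _

/-- Consequently a subspace stable under every `leftAct p` and contained in ker ε is zero. -/
theorem counit_leftAct (p : Module.Dual k A) (a : A) : counit (R := k) (leftAct p a) = p a := by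
  have h : rightAct (counit (R := k)) a = a := by
    rw [rightAct_repr _ (ℛ k a), sum_counit_smul]
  rw [apply_leftAct, h]

theorem commute_rightAct_leftAct (p q : Module.Dual k A) : Commute (rightAct p) (leftAct q) := by
  ext a
  have h := sum_tmul_tmul_eq (ℛ k a) (fun i => ℛ k ((ℛ k a).left i))
    (fun i => ℛ k ((ℛ k a).right i))
  have h' := congr(contractFst p (LinearMap.lTensor A (contractSnd q) $h))
  simp only [map_sum, LinearMap.lTensor_tmul, contractSnd_tmul, contractFst_tmul] at h'
  simp only [Module.End.mul_apply]
  rw [leftAct_repr q (ℛ k a), rightAct_repr p (ℛ k a)]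
  simp only [map_sum, map_smul]
  simp only [fun i => rightAct_repr p (ℛ k ((ℛ k a).left i)),
    fun i => leftAct_repr q (ℛ k ((ℛ k a).right i)), Finset.smul_sum]
  exact (Finset.sum_congr rfl fun i _ => Finset.sum_congr rfl fun j _ => smul_comm _ _ _).trans h'

end CoalgebraActions

/-! ### Antipode identities in A ⊗ A by convolution inverses. -/

section Convolution

variable {k A B : Type*} [Field k] [Ring A] [HopfAlgebra k A] [Ring B] [Algebra k B]

theorem conv_comp_antipode_mul (h : A →ₐ[k] B) :
    toConv (h.toLinearMap ∘ₗ antipode k (A := A)) * toConv h.toLinearMap = 1 := by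
  have := LinearMap.algHom_comp_convMul_distrib h (toConv (antipode k (A := A)))
    (toConv LinearMap.id)
  rw [LinearMap.antipode_mul_id] at this
  apply WithConv.ofConv_injective
  simp only [LinearMap.comp_id] at this
  rw [← this]
  ext x
  simp [LinearMap.convOne_def]

theorem conv_mul_comp_antipode (h : A →ₐ[k] B) :
    toConv h.toLinearMap * toConv (h.toLinearMap ∘ₗ antipode k (A := A)) = 1 := by
  have := LinearMap.algHom_comp_convMul_distrib h (toConv LinearMap.id)
    (toConv (antipode k (A := A)))
  rw [LinearMap.id_mul_antipode] at this
  apply WithConv.ofConv_injective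
  simp only [LinearMap.comp_id] at this
  rw [← this]
  ext x
  simp [LinearMap.convOne_def]

variable (k A) in
/-- The map `a ↦ a ⊗ 1`. -/
noncomputable abbrev inclL : A →ₐ[k] A ⊗[k] A := Algebra.TensorProduct.includeLeft

variable (k A) in
/-- The map `a ↦ 1 ⊗ a`. -/
noncomputable abbrev inclR : A →ₐ[k] A ⊗[k] A := Algebra.TensorProduct.includeRight

theorem conv_inclL_mul_inclR :
    toConv (inclL k A).toLinearMap * toConv (inclR k A).toLinearMap =
      toConv (comulAlgHom k A).toLinearMap := by
  ext x
  rw [(ℛ k x).convMul_apply]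
  simp [(ℛ k x).eq]

/-- Since Δ = `inclL` * `inclR` under convolution, both sides are inverses of `inclR`, one on the
left and one on the right. -/
theorem conv_comul_comp_antipode_mul_inclL :
    toConv ((comulAlgHom k A).toLinearMap ∘ₗ antipode k (A := A)) * toConv (inclL k A).toLinearMap =
      toConv ((inclR k A).toLinearMap ∘ₗ antipode k (A := A)) := by
  have h := conv_comp_antipode_mul (comulAlgHom k A)
  rw [← conv_inclL_mul_inclR, ← mul_assoc] at h
  exact left_inv_eq_right_inv h (conv_mul_comp_antipode (inclR k A))

theorem conv_inclR_mul_comul_comp_antipode :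
    toConv (inclR k A).toLinearMap * toConv ((comulAlgHom k A).toLinearMap ∘ₗ antipode k (A := A)) =
      toConv ((inclL k A).toLinearMap ∘ₗ antipode k (A := A)) := by
  have h := conv_mul_comp_antipode (comulAlgHom k A)
  rw [← conv_inclL_mul_inclR, mul_assoc] at h
  exact (left_inv_eq_right_inv (conv_comp_antipode_mul (inclL k A)) h).symm

theorem conv_comul_mul_inclR_comp_antipode :
    toConv (comulAlgHom k A).toLinearMap * toConv ((inclR k A).toLinearMap ∘ₗ antipode k (A := A)) =
      toConv (inclL k A).toLinearMap := by
  rw [← conv_inclL_mul_inclR, mul_assoc, conv_mul_comp_antipode, mul_one]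

theorem conv_comul_comp_antipode :
    toConv ((comulAlgHom k A).toLinearMap ∘ₗ antipode k (A := A)) =
      toConv ((inclR k A).toLinearMap ∘ₗ antipode k (A := A)) *
        toConv ((inclL k A).toLinearMap ∘ₗ antipode k (A := A)) := by
  rw [← conv_comul_comp_antipode_mul_inclL, mul_assoc, conv_mul_comp_antipode, mul_one]

variable {a : A} {ι : Type*}

/-- `1 ⊗ s(a) = Δ(s(a₍₁₎)) (a₍₂₎ ⊗ 1)`. -/
theorem sum_comul_antipode_mul_tmul_one (R : Coalgebra.Repr k a ι) :
    ∑ i ∈ R.index, comul (R := k) (antipode k (R.left i)) * (R.right i ⊗ₜ[k] (1 : A)) =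
      1 ⊗ₜ antipode k a := by
  have h := congr($(conv_comul_comp_antipode_mul_inclL (k := k) (A := A)) a)
  rw [R.convMul_apply] at h
  simpa using h

/-- `s(a) ⊗ 1 = (1 ⊗ a₍₁₎) Δ(s(a₍₂₎))`. -/
theorem sum_one_tmul_mul_comul_antipode (R : Coalgebra.Repr k a ι) :
    ∑ i ∈ R.index, ((1 : A) ⊗ₜ[k] R.left i) * comul (R := k) (antipode k (R.right i)) =
      antipode k a ⊗ₜ 1 := by
  have h := congr($(conv_inclR_mul_comul_comp_antipode (k := k) (A := A)) a)
  rw [R.convMul_apply] at h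
  simpa using h

/-- `a ⊗ 1 = Δ(a₍₁₎) (1 ⊗ s(a₍₂₎))`. -/
theorem sum_comul_mul_one_tmul_antipode (R : Coalgebra.Repr k a ι) :
    ∑ i ∈ R.index, comul (R := k) (R.left i) * ((1 : A) ⊗ₜ[k] antipode k (R.right i)) =
      a ⊗ₜ 1 := by
  have h := congr($(conv_comul_mul_inclR_comp_antipode (k := k) (A := A)) a)
  rw [R.convMul_apply] at h
  simpa using h

/-- The representation `Δ(s(a)) = s(a₍₂₎) ⊗ s(a₍₁₎)`. -/
noncomputable def antipodeRepr (R : Coalgebra.Repr k a ι) :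
    Coalgebra.Repr k (antipode k a) ι where
  index := R.index
  left i := antipode k (R.right i)
  right i := antipode k (R.left i)
  eq := by
    have h := congr($(conv_comul_comp_antipode (k := k) (A := A)) a)
    rw [R.convMul_apply] at h
    simpa using h.symm

/-- `1 ⊗ s²(a) = Δ(s²(a₍₂₎)) (s(a₍₁₎) ⊗ 1)`. -/
theorem sum_comul_antipode_antipode_mul_tmul_one (R : Coalgebra.Repr k a ι) :
    ∑ i ∈ R.index, comul (R := k) (antipode k (antipode k (R.right i))) *
      (antipode k (R.left i) ⊗ₜ[k] (1 : A)) = 1 ⊗ₜ antipode k (antipode k a) :=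
  sum_comul_antipode_mul_tmul_one (antipodeRepr R)

/-- `a₍₁₎ s(a₍₂₎) ⊗ a₍₃₎ = 1 ⊗ a`. -/
theorem sum_tmul_one_mul_map_antipode_comul (R : Coalgebra.Repr k a ι) :
    ∑ i ∈ R.index, (R.left i ⊗ₜ[k] (1 : A)) *
      LinearMap.rTensor A (antipode k) (comul (R.right i)) = 1 ⊗ₜ a := by
  have h : toConv (inclL k A).toLinearMap *
      (toConv ((inclL k A).toLinearMap ∘ₗ antipode k (A := A)) * toConv (inclR k A).toLinearMap) =
      toConv (inclR k A).toLinearMap := by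
    rw [← mul_assoc, conv_mul_comp_antipode, one_mul]
  have h2 : toConv ((inclL k A).toLinearMap ∘ₗ antipode k (A := A)) *
      toConv (inclR k A).toLinearMap = toConv (LinearMap.rTensor A (antipode k) ∘ₗ comul) := by
    ext x
    rw [(ℛ k x).convMul_apply]
    simp [← (ℛ k x).eq]
  rw [h2] at h
  have h3 := congr($h a)
  rw [R.convMul_apply] at h3
  simpa using h3

end Convolution

/-! ### Trace functionals, integrals and the map 𝓔. -/

section Integrals

variable {k A : Type*} [Field k] [Ring A] [HopfAlgebra k A]

theorem contractFst_tmul_one_mul (q : Module.Dual k A) (w : A) (t : A ⊗[k] A) :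
    contractFst q ((w ⊗ₜ[k] (1 : A)) * t) = contractFst (q ∘ₗ LinearMap.mulLeft k w) t := by
  induction t with
  | zero => simp
  | tmul u v => simp
  | add u v hu hv => simp [mul_add, hu, hv]

theorem contractFst_mul_tmul_one (q : Module.Dual k A) (w : A) (t : A ⊗[k] A) :
    contractFst q (t * (w ⊗ₜ[k] (1 : A))) = contractFst (q ∘ₗ LinearMap.mulRight k w) t := by
  induction t with
  | zero => simp
  | tmul u v => simp
  | add u v hu hv => simp [add_mul, hu, hv]

theorem contractFst_mul_one_tmul (q : Module.Dual k A) (w : A) (t : A ⊗[k] A) :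
    contractFst q (t * ((1 : A) ⊗ₜ[k] w)) = contractFst q t * w := by
  induction t with
  | zero => simp
  | tmul u v => simp
  | add u v hu hv => simp [add_mul, hu, hv]

theorem contractFst_one_tmul_mul (q : Module.Dual k A) (w : A) (t : A ⊗[k] A) :
    contractFst q (((1 : A) ⊗ₜ[k] w) * t) = w * contractFst q t := by
  induction t with
  | zero => simp
  | tmul u v => simp
  | add u v hu hv => simp [mul_add, hu, hv]

theorem contractFst_rTensor (q : Module.Dual k A) (g : Module.End k A) (t : A ⊗[k] A) :
    contractFst q (LinearMap.rTensor A g t) = contractFst (q ∘ₗ g) t := by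
  induction t with
  | zero => simp
  | tmul u v => simp
  | add u v hu hv => simp [hu, hv]

theorem sum_coord_contractFst {ι : Type*} [Fintype ι] (e : Module.Basis ι k A)
    (g : Module.Dual k A) (t : A ⊗[k] A) :
    ∑ i, g (e i) • contractFst (e.coord i) t = contractFst g t := by
  induction t with
  | zero => simp
  | tmul u v =>
    simp only [contractFst_tmul, smul_smul, ← Finset.sum_smul]
    congr 1
    conv_rhs => rw [← e.sum_repr u]
    simp only [map_sum, map_smul, smul_eq_mul, Module.Basis.coord_apply, mul_comm]
  | add u v hu hv => simp [Finset.sum_add_distrib, smul_add, hu, hv]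


/-- Multiply 1 ⊗ s²(x) = Δ(s²(x₍₂₎))(s(x₍₁₎) ⊗ 1) by Δ(b) and contract with `q`; the dual bases
separate the two factors inside `q`, so that `rightAct` stands at both ends and can be cycled under
a trace. -/
theorem sum_rightAct_mul_antipode_antipode {ι : Type*} [Fintype ι] (e : Module.Basis ι k A)
    (q : Module.Dual k A) (b x : A) :
    ∑ i, rightAct (e.coord i) (b * antipode k (antipode k
      (rightAct ((q ∘ₗ LinearMap.mulLeft k (e i)) ∘ₗ antipode k) x))) =
      rightAct q b * antipode k (antipode k x) := by
  have h := congr(contractFst q (comul b * $(sum_comul_antipode_antipode_mul_tmul_one (ℛ k x))))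
  simp only [Finset.mul_sum, map_sum, ← mul_assoc, contractFst_mul_tmul_one,
    contractFst_mul_one_tmul, ← Bialgebra.comul_mul, ← rightAct_eq] at h
  rw [← h]
  simp only [rightAct_repr _ (ℛ k x), map_sum, Finset.mul_sum, map_smul, mul_smul_comm]
  rw [Finset.sum_comm]
  refine Finset.sum_congr rfl fun j _ => ?_
  simp only [rightAct_eq]
  rw [← sum_coord_contractFst e]
  rfl

theorem sum_rightAct_rightAct {ι : Type*} [Fintype ι] (e : Module.Basis ι k A)
    (q : Module.Dual k A) (x : A) :
    ∑ i, rightAct ((q ∘ₗ LinearMap.mulLeft k (e i)) ∘ₗ antipode k) (rightAct (e.coord i) x) =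
      q 1 • x := by
  have h := congr(contractFst q $(sum_tmul_one_mul_map_antipode_comul (ℛ k x)))
  simp only [map_sum, contractFst_tmul_one_mul, contractFst_tmul, contractFst_rTensor,
    ← rightAct_eq] at h
  rw [← h]
  simp only [rightAct_repr (e.coord _) (ℛ k x), map_sum, map_smul]
  rw [Finset.sum_comm]
  refine Finset.sum_congr rfl fun j _ => ?_
  simp only [rightAct_eq]
  generalize comul (R := k) ((ℛ k x).right j) = t
  generalize (ℛ k x).left j = y
  induction t with
  | zero => simp
  | tmul u v =>
    simp only [contractFst_tmul, LinearMap.comp_apply, LinearMap.mulLeft_apply, smul_smul,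
      ← Finset.sum_smul]
    congr 1
    conv_rhs => rw [← e.sum_repr y]
    simp only [Finset.sum_mul, map_sum, smul_mul_assoc, map_smul, smul_eq_mul,
      Module.Basis.coord_apply]
  | add u v hu hv => simp only [map_add, smul_add, Finset.sum_add_distrib, hu, hv]

/-- The functional `b ↦ tr(leftAct p ∘ ℓ(b) ∘ s²)`. -/
noncomputable def traceIntegral (p : Module.Dual k A) : Module.Dual k A :=
  LinearMap.trace k A ∘ₗ LinearMap.mulLeft k (leftAct p) ∘ₗ
    LinearMap.mulRight k (antipode k * antipode k : Module.End k A) ∘ₗ LinearMap.mul k A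

theorem traceIntegral_apply (p : Module.Dual k A) (b : A) :
    traceIntegral p b = LinearMap.trace k A
      (leftAct p * (LinearMap.mulLeft k b * (antipode k * antipode k))) := rfl

theorem contractSnd_mul_tmul_one (p : Module.Dual k A) (w : A) (t : A ⊗[k] A) :
    contractSnd p (t * (w ⊗ₜ[k] (1 : A))) = contractSnd p t * w := by
  induction t with
  | zero => simp
  | tmul u v => simp
  | add u v hu hv => simp [add_mul, hu, hv]

/-- If `b₍₁₎ lam(b₍₂₎) = lam(b) 1`, then `lam(b s(a₍₁₎)) a₍₂₎ = b₍₁₎ lam(b₍₂₎ s(a))`. -/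
theorem sum_smul_of_leftAct_eq {lam : Module.Dual k A}
    (hlam : ∀ b, leftAct lam b = lam b • (1 : A)) {ι : Type*} {a : A}
    (R : Coalgebra.Repr k a ι) (b : A) :
    ∑ i ∈ R.index, lam (b * antipode k (R.left i)) • R.right i =
      contractSnd lam (comul b * ((1 : A) ⊗ₜ antipode k a)) := by
  rw [← sum_comul_antipode_mul_tmul_one R]
  simp only [Finset.mul_sum, map_sum, ← mul_assoc, ← Bialgebra.comul_mul,
    contractSnd_mul_tmul_one, ← leftAct_eq, hlam, smul_mul_assoc, one_mul]

theorem apply_mul_antipode_leftAct {lam : Module.Dual k A}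
    (hlam : ∀ b, leftAct lam b = lam b • (1 : A)) (q : Module.Dual k A) (a b : A) :
    lam (b * antipode k (leftAct q a)) = lam (rightAct q b * antipode k a) := by
  have h := congr(q $(sum_smul_of_leftAct_eq hlam (ℛ k a) b))
  rw [apply_contractSnd, contractFst_mul_one_tmul, ← rightAct_eq] at h
  rw [← h, leftAct_repr q (ℛ k a)]
  simp [Finset.mul_sum, mul_comm]

/-- If `lam(b₍₁₎) b₍₂₎ = lam(b) 1`, then `lam(s(a) b₍₁₎) b₍₂₎ = a₍₁₎ lam(s(a₍₂₎) b)`. -/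
theorem rightAct_comp_mulLeft_antipode {lam : Module.Dual k A}
    (hlam : ∀ b, rightAct lam b = lam b • (1 : A)) {ι : Type*} {a : A}
    (R : Coalgebra.Repr k a ι) (b : A) :
    rightAct (lam ∘ₗ LinearMap.mulLeft k (antipode k a)) b =
      ∑ i ∈ R.index, lam (antipode k (R.right i) * b) • R.left i := by
  rw [rightAct_eq, ← contractFst_tmul_one_mul, ← sum_one_tmul_mul_comul_antipode R]
  simp only [Finset.sum_mul, map_sum, mul_assoc, ← Bialgebra.comul_mul,
    contractFst_one_tmul_mul, ← rightAct_eq, hlam, mul_smul_comm, mul_one]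

/-- `p(x₍₁₎ b) x₍₂₎ = p((x b₍₁₎)₍₁₎) (x b₍₁₎)₍₂₎ s(b₍₂₎)`. -/
theorem rightAct_comp_mulRight (p : Module.Dual k A) {ι : Type*} {b : A}
    (R : Coalgebra.Repr k b ι) (x : A) :
    rightAct (p ∘ₗ LinearMap.mulRight k b) x =
      ∑ i ∈ R.index, rightAct p (x * R.left i) * antipode k (R.right i) := by
  rw [rightAct_eq, ← contractFst_mul_tmul_one, ← sum_comul_mul_one_tmul_antipode R]
  simp only [Finset.mul_sum, map_sum, ← mul_assoc, ← Bialgebra.comul_mul,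
    contractFst_mul_one_tmul, ← rightAct_eq]

theorem isDualRightIntegral_of_rightAct_eq {lam : Module.Dual k A}
    (hlam : ∀ b, rightAct lam b = lam b • (1 : A)) : IsDualRightIntegral lam := by
  intro p
  ext b
  simp [dualMul_eq, hlam, mul_comm]

/-- Γb = ε(b)Γ shows that the functional b ↦ `lam (Γ * b)` depends only on `lam Γ`. -/
theorem IsRightIntegral.eq_smul {lam : Module.Dual k A}
    (hnd : ∀ y, (∀ b, lam (y * b) = 0) → y = 0) {Λ Γ : A} (hΛ : IsRightIntegral k Λ)
    (hone : lam Λ = 1) (hΓ : IsRightIntegral k Γ) : Γ = lam Γ • Λ := by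
  rw [← sub_eq_zero]
  refine hnd _ fun b => ?_
  rw [sub_mul, hΓ, smul_mul_assoc, hΛ]
  simp [hone, mul_comm]

theorem isIntegralCointegral_smulRight {lam : Module.Dual k A}
    (hlam : ∀ b, rightAct lam b = lam b • (1 : A)) {Λ : A} (hΛ : IsRightIntegral k Λ) :
    IsIntegralCointegral (lam.smulRight Λ) := by
  refine ⟨fun a => ?_, fun a b => ?_⟩
  · have h := hlam a
    rw [rightAct_repr _ (ℛ k a)] at h
    have h' := congr(Λ ⊗ₜ[k] $h)
    rw [← (ℛ k a).eq]
    simpa [TensorProduct.tmul_sum, TensorProduct.smul_tmul] using h'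
  · rw [LinearMap.smulRight_apply, smul_mul_assoc, hΛ, smul_comm]

variable [Module.Finite k A]

theorem traceIntegral_rightAct (p q : Module.Dual k A) (b : A) :
    traceIntegral p (rightAct q b) = q 1 * traceIntegral p b := by
  let e := Module.finBasis k A
  let g := fun i => rightAct ((q ∘ₗ LinearMap.mulLeft k (e i)) ∘ₗ antipode k)
  let M : Module.End k A := LinearMap.mulLeft k b * (antipode k * antipode k)
  have h1 : LinearMap.mulLeft k (rightAct q b) * (antipode k * antipode k : Module.End k A) =
      ∑ i, rightAct (e.coord i) * (M * g i) := by
    ext x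
    simpa [M, g, LinearMap.sum_apply] using (sum_rightAct_mul_antipode_antipode e q b x).symm
  have h2 : ∑ i, g i * rightAct (e.coord i) = q 1 • (1 : Module.End k A) := by
    ext x
    simpa [g, LinearMap.sum_apply] using sum_rightAct_rightAct e q x
  -- `rightAct` commutes with `leftAct p`, so it passes to the front and then around the trace to
  -- meet `g i`, where `h2` collapses the sum.
  have h3 : ∀ i, LinearMap.trace k A (leftAct p * (rightAct (e.coord i) * (M * g i))) =
      LinearMap.trace k A (leftAct p * (M * (g i * rightAct (e.coord i)))) := fun i => by
    rw [← mul_assoc, ← (commute_rightAct_leftAct (e.coord i) p).eq, mul_assoc,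
      LinearMap.trace_mul_comm]
    simp only [mul_assoc]
  rw [traceIntegral_apply, h1, Finset.mul_sum, map_sum]
  simp only [h3]
  rw [← map_sum, ← Finset.mul_sum, ← Finset.mul_sum, h2]
  simp [traceIntegral_apply, M]

theorem exists_traceIntegral_ne_zero : ∃ p : Module.Dual k A, traceIntegral p ≠ 0 := by
  by_contra! h
  let e := Module.finBasis k A
  have h1 : ∑ i, LinearMap.mulLeft k (antipode k (e i)) * (antipode k * antipode k) *
      leftAct (e.coord i) = (counit (R := k) (A := A)).smulRight (1 : A) := by
    ext x
    have h2 := congr(antipode k $(sum_antipode_mul_eq_smul (ℛ k x)))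
    simp only [map_sum, antipode_mul_antidistrib, map_smul, antipode_one] at h2
    simp only [LinearMap.sum_apply, Module.End.mul_apply, LinearMap.smulRight_apply, ← h2,
      leftAct_repr _ (ℛ k x), map_sum, map_smul, LinearMap.mulLeft_apply]
    rw [Finset.sum_comm]
    refine Finset.sum_congr rfl fun j _ => ?_
    conv_rhs => rw [← e.sum_repr ((ℛ k x).right j)]
    simp only [map_sum, map_smul, Finset.sum_mul, smul_mul_assoc, Module.Basis.coord_apply]
  have h2 := congr(LinearMap.trace k A $h1)
  rw [map_sum, LinearMap.trace_smulRight, counit_one, Finset.sum_eq_zero] at h2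
  · exact zero_ne_one h2
  · intro i _
    rw [LinearMap.trace_mul_comm, ← traceIntegral_apply, h, LinearMap.zero_apply]


theorem eq_zero_of_forall_apply_mul_antipode {lam : Module.Dual k A} (hne : lam ≠ 0)
    (hlam : ∀ b, leftAct lam b = lam b • (1 : A)) {a : A}
    (ha : ∀ b, lam (b * antipode k a) = 0) : a = 0 := by
  let e := Module.finBasis k A
  have hcounit : ∀ c : A, (∀ b, lam (b * antipode k c) = 0) → counit (R := k) c = 0 := by
    intro c hc
    obtain ⟨b, hb⟩ : ∃ b, lam b ≠ 0 := by
      by_contra! h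
      exact hne (LinearMap.ext h)
    -- c₍₁₎s(c₍₂₎) = ε(c)1 with c₍₂₎ expanded in a basis. After applying s, every term puts some
    -- s(`leftAct _ c`) on the right, and `lam` kills it.
    have h1 : ∑ i, leftAct (e.coord i) c * antipode k (e i) = counit (R := k) c • 1 := by
      rw [← sum_mul_antipode_eq_smul (ℛ k c)]
      simp only [leftAct_repr _ (ℛ k c), Finset.sum_mul]
      rw [Finset.sum_comm]
      refine Finset.sum_congr rfl fun j _ => ?_
      conv_rhs => rw [← e.sum_repr ((ℛ k c).right j)]
      simp only [map_sum, map_smul, Finset.mul_sum, smul_mul_assoc, mul_smul_comm,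
        Module.Basis.coord_apply]
    have h2 := congr(lam (b * antipode k $h1))
    simp only [map_sum, antipode_mul_antidistrib, Finset.mul_sum, map_smul, antipode_one,
      mul_smul_comm, mul_one, ← mul_assoc, apply_mul_antipode_leftAct hlam, hc,
      Finset.sum_const_zero, smul_eq_mul] at h2
    exact (mul_eq_zero.mp h2.symm).resolve_right hb
  -- The radical is stable under `leftAct q` and lies in ker ε.
  rw [← Module.forall_dual_apply_eq_zero_iff k]
  intro q
  rw [← counit_leftAct]
  exact hcounit _ fun b => by rw [apply_mul_antipode_leftAct hlam, ha]

variable (k A) in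
theorem exists_leftAct_eq :
    ∃ lam : Module.Dual k A, lam ≠ 0 ∧ ∀ b, leftAct lam b = lam b • (1 : A) := by
  obtain ⟨p, hp⟩ := exists_traceIntegral_ne_zero (k := k) (A := A)
  refine ⟨traceIntegral p, hp, fun b => ?_⟩
  rw [← sub_eq_zero, ← Module.forall_dual_apply_eq_zero_iff k]
  intro q
  rw [map_sub, apply_leftAct, traceIntegral_rightAct, map_smul, smul_eq_mul, mul_comm, sub_self]

variable (k A) in
theorem antipode_injective : Function.Injective (antipode k : A →ₗ[k] A) := by
  obtain ⟨lam, hne, hlam⟩ := exists_leftAct_eq k A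
  rw [injective_iff_map_eq_zero]
  intro a ha
  exact eq_zero_of_forall_apply_mul_antipode hne hlam fun b => by simp [ha]

variable (k A) in
/-- The antipode of a finite-dimensional Hopf algebra as a linear automorphism. -/
noncomputable def antipodeEquiv : A ≃ₗ[k] A :=
  LinearEquiv.ofInjectiveEndo (antipode k) (antipode_injective k A)

@[simp] theorem antipodeEquiv_apply (a : A) : antipodeEquiv k A a = antipode k a := rfl

@[simp] theorem antipode_antipodeEquiv_symm (a : A) :
    antipode k ((antipodeEquiv k A).symm a) = a := (antipodeEquiv k A).apply_symm_apply a

theorem antipodeEquiv_symm_mul (a b : A) : (antipodeEquiv k A).symm (a * b) =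
    (antipodeEquiv k A).symm b * (antipodeEquiv k A).symm a := by
  apply antipode_injective k A
  simp [antipode_mul_antidistrib]

theorem antipodeEquiv_symm_one : (antipodeEquiv k A).symm 1 = 1 := by
  apply antipode_injective k A
  simp

theorem sum_antipodeEquiv_symm_mul {ι : Type*} {a : A} (R : Coalgebra.Repr k a ι) :
    ∑ i ∈ R.index, (antipodeEquiv k A).symm (R.right i) * R.left i = counit (R := k) a • 1 := by
  apply antipode_injective k A
  simp [antipode_mul_antidistrib, sum_antipode_mul_eq_smul]

variable (k A) in
/-- There is a nondegenerate right integral for `A*`. -/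
theorem exists_rightAct_eq_nondegenerate :
    ∃ lam : Module.Dual k A, (∀ b, rightAct lam b = lam b • (1 : A)) ∧
      ∀ y, (∀ b, lam (y * b) = 0) → y = 0 := by
  obtain ⟨lam, hne, hlam⟩ := exists_leftAct_eq k A
  -- s reverses the coproduct, which exchanges the two kinds of invariance.
  refine ⟨lam ∘ₗ antipode k, fun b => ?_, fun y hy => ?_⟩
  · apply antipode_injective k A
    have h := hlam (antipode k b)
    rw [leftAct_repr _ (antipodeRepr (ℛ k b))] at h
    rw [rightAct_repr _ (ℛ k b)]
    simpa [antipodeRepr] using h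
  · refine eq_zero_of_forall_apply_mul_antipode hne hlam fun b => ?_
    simpa [antipode_mul_antidistrib] using hy ((antipodeEquiv k A).symm b)

/-- The isomorphism `a ↦ lam ↼ s(a)` given by a nondegenerate functional. -/
noncomputable def dualIso (lam : Module.Dual k A)
    (hnd : ∀ y, (∀ b, lam (y * b) = 0) → y = 0) : A ≃ₗ[k] Module.Dual k A :=
  LinearMap.linearEquivOfInjective
    ((LinearMap.mul k A ∘ₗ antipode k).compr₂ lam)
    (by
      rw [injective_iff_map_eq_zero]
      intro a ha
      refine antipode_injective k A ?_
      rw [map_zero]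
      exact hnd _ fun b => congr($ha b))
    Subspace.dual_finrank_eq.symm

theorem dualIso_apply (lam : Module.Dual k A)
    (hnd : ∀ y, (∀ b, lam (y * b) = 0) → y = 0) (a : A) :
    dualIso lam hnd a = dualRightAct lam (antipode k a) := rfl

theorem exists_isRightIntegral_apply_eq_one (lam : Module.Dual k A)
    (hnd : ∀ y, (∀ b, lam (y * b) = 0) → y = 0) :
    ∃ Λ : A, IsRightIntegral k Λ ∧ lam Λ = 1 := by
  obtain ⟨c, hc⟩ := (dualIso lam hnd).surjective (counit (R := k))
  have h : ∀ b, lam (antipode k c * b) = counit (R := k) b := fun b => congr($hc b)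
  refine ⟨antipode k c, fun a => ?_, ?_⟩
  · rw [← sub_eq_zero]
    refine hnd _ fun b => ?_
    rw [sub_mul, map_sub, mul_assoc, h, smul_mul_assoc, map_smul, h, Bialgebra.counit_mul,
      smul_eq_mul, sub_self]
  · simpa using h 1

/-- The values of `𝓔(s⁻²)` are right integrals. -/
theorem isRightIntegral_calE (a : A) : IsRightIntegral k
    (calE ((antipodeEquiv k A).symm.toLinearMap ∘ₗ (antipodeEquiv k A).symm.toLinearMap) a) := by
  intro b
  rw [← sub_eq_zero, ← Module.forall_dual_apply_eq_zero_iff k]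
  intro p
  set t : A →ₗ[k] A := (antipodeEquiv k A).symm.toLinearMap with ht
  change p (LinearMap.mulRight k b (calE (t ∘ₗ t) a) - _) = 0
  rw [map_sub, sub_eq_zero, map_smul, ← LinearMap.comp_apply, apply_calE, apply_calE]
  let R := ℛ k b
  have h1 : LinearMap.mulLeft k a ∘ₗ (t ∘ₗ t) ∘ₗ rightAct (p ∘ₗ LinearMap.mulRight k b) =
      ∑ i ∈ R.index, (LinearMap.mulLeft k a * (t * t) *
        LinearMap.mulRight k (antipode k (R.right i)) * rightAct p) *
        LinearMap.mulRight k (R.left i) := by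
    ext x
    simp [rightAct_comp_mulRight p R, LinearMap.sum_apply]
  -- Cycling right multiplication by b₍₁₎ to the front produces s⁻²(s(b₍₂₎))b₍₁₎ = s⁻¹(b₍₂₎)b₍₁₎,
  -- which sums to ε(b)1.
  have h2 : ∑ i ∈ R.index, LinearMap.mulRight k (R.left i) * (LinearMap.mulLeft k a * (t * t) *
        LinearMap.mulRight k (antipode k (R.right i)) * rightAct p) =
      counit (R := k) b • (LinearMap.mulLeft k a ∘ₗ (t ∘ₗ t) ∘ₗ rightAct p) := by
    ext x
    have h3 := congr(a * (t (t (rightAct p x)) * $(sum_antipodeEquiv_symm_mul R)))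
    have h4 : ∀ y, (antipodeEquiv k A).symm (antipode k y) = y :=
      (antipodeEquiv k A).symm_apply_apply
    simp only [Finset.mul_sum, mul_smul_comm, mul_one] at h3
    simpa [LinearMap.sum_apply, ht, antipodeEquiv_symm_mul, h4, mul_assoc] using h3
  rw [h1, map_sum]
  simp only [LinearMap.trace_mul_comm k _ (LinearMap.mulRight k (R.left _))]
  rw [← map_sum, h2, map_smul]

/-- By invariance r(λ) has image in k·1, fixed by s⁻², so the operator under the trace is the
rank-one map x ↦ λ(x)a. -/
theorem apply_calE_antipodeEquiv_symm {lam : Module.Dual k A}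
    (hlam : ∀ b, rightAct lam b = lam b • (1 : A)) (a : A) :
    lam (calE ((antipodeEquiv k A).symm.toLinearMap ∘ₗ (antipodeEquiv k A).symm.toLinearMap) a) =
      lam a := by
  rw [apply_calE]
  have h : LinearMap.mulLeft k a ∘ₗ ((antipodeEquiv k A).symm.toLinearMap ∘ₗ
      (antipodeEquiv k A).symm.toLinearMap) ∘ₗ rightAct lam = lam.smulRight a := by
    ext x
    simp [hlam, antipodeEquiv_symm_one]
  rw [h, LinearMap.trace_smulRight]

theorem calE_antipodeEquiv_symm {lam : Module.Dual k A}
    (hlam : ∀ b, rightAct lam b = lam b • (1 : A))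
    (hnd : ∀ y, (∀ b, lam (y * b) = 0) → y = 0) {Λ : A} (hΛ : IsRightIntegral k Λ)
    (hone : lam Λ = 1) :
    calE ((antipodeEquiv k A).symm.toLinearMap ∘ₗ (antipodeEquiv k A).symm.toLinearMap) =
      lam.smulRight Λ := by
  ext a
  rw [hΛ.eq_smul hnd hone (isRightIntegral_calE a), apply_calE_antipodeEquiv_symm hlam]
  rfl

end Integrals

end HopfTrace

open HopfTrace in
theorem mainTheorem2 {k A : Type*} [Field k] [Ring A] [HopfAlgebra k A] [Module.Finite k A] :
    ∃ s : A ≃ₗ[k] A, s.toLinearMap = HopfAlgebra.antipode k (A := A) ∧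
      HopfTrace.IsIntegralCointegral
        (HopfTrace.calE (s.symm.toLinearMap ∘ₗ s.symm.toLinearMap)) ∧
      HopfTrace.calE (s.symm.toLinearMap ∘ₗ s.symm.toLinearMap) ≠ 0 ∧
      LinearMap.trace k A
        (HopfTrace.calE (s.symm.toLinearMap ∘ₗ s.symm.toLinearMap)) ≠ 0 ∧
      ∃ (lam : Module.Dual k A) (Λ : A),
        HopfTrace.IsDualRightIntegral lam ∧ HopfTrace.IsRightIntegral k Λ ∧ lam Λ = 1 ∧
        ∃ f : A ≃ₗ[k] Module.Dual k A,
          (∀ a : A, f a = HopfTrace.dualRightAct lam (s a)) ∧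
          (∀ a b : A, f (a * b) = HopfTrace.dualRightAct (f b) (s a)) ∧
          (∀ (a : A) (p : Module.Dual k A),
            f (HopfTrace.rightAct p a) = HopfTrace.dualMul (f a) p) := by
  obtain ⟨lam, hlam, hnd⟩ := exists_rightAct_eq_nondegenerate k A
  obtain ⟨Λ, hΛ, hone⟩ := exists_isRightIntegral_apply_eq_one lam hnd
  have htr : LinearMap.trace k A (lam.smulRight Λ) ≠ 0 := by
    rw [LinearMap.trace_smulRight, hone]
    exact one_ne_zero
  refine ⟨antipodeEquiv k A, rfl, ?_⟩
  rw [calE_antipodeEquiv_symm hlam hnd hΛ hone]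
  refine ⟨isIntegralCointegral_smulRight hlam hΛ, fun h => htr (by rw [h, map_zero]), htr,
    lam, Λ, isDualRightIntegral_of_rightAct_eq hlam, hΛ, hone, dualIso lam hnd,
    fun a => rfl, fun a b => ?_, fun a p => ?_⟩
  · ext c
    simp [dualIso_apply, dualRightAct, antipode_mul_antidistrib]
  · ext b
    rw [dualMul_eq, dualIso_apply, dualIso_apply]
    have h := congr(p $(rightAct_comp_mulLeft_antipode hlam (ℛ k a) b))
    rw [dualRightAct, dualRightAct, h, rightAct_repr p (ℛ k a)]
    simp [Finset.sum_mul, mul_comm]
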